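/- Let $K>0$ and $0<c<1$ be fixed. For $n\ge 1$ let $A=(a_{ij})_{1\le i,j\le n}$ be a random real $n\times n$ matrix whose entries are independent random variables (not necessarily identically distributed, and with arbitrary means) satisfying, for all $i,j$, $$c\le \mathbf{Var}(a_{ij})\le \frac1c\qquad\text{and}\qquad \mathbf{P}\bigl(|a_{ij}-\mathbf{E}(a_{ij})|\le K\bigr)=1 .$$ Let $0\le\sigma_1(A)\le\sigma_2(A)\le\dots\le\sigma_n(A)$ be the singular values of $A$, counted with multiplicity and listed in increasing order. Then for integers $r$ with $r\ge 1$, $\log^4 n\le r$ and $2r\le n$, $$\mathbf{P}\left(\sigma_{2r}(A)\le \frac{r c^2}{2\sqrt{n-r}}\right)=o\bigl(n^{-\log n}\bigr)\qquad (n\to\infty),$$ where $\log$ is the natural logarithm and the $o(\cdot)$ depends only on $K$ and $c$: there is a function $f=f_{K,c}$ on the positive integers with $f(n)\,n^{\log n}\to 0$ such that the probability is at most $f(n)$ for all $n$, all such $r$ and all such random matrices $A$. -/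

import Mathlib

/-- The `k`-th smallest singular value `σ_k(A)` (for `1 ≤ k ≤ n`, counted with multiplicity) of a
real `n × n` matrix, so that `0 ≤ σ_1(A) ≤ σ_2(A) ≤ ⋯ ≤ σ_n(A)`. Mathlib lists the singular
values of a linear map in decreasing order starting from index `0`, so the `k`-th smallest of `n`
is the one with index `n - k`. Values of `k` outside `1, …, n` are not meaningful. -/
noncomputable def ascSingularValue {n : ℕ} (A : Matrix (Fin n) (Fin n) ℝ) (k : ℕ) : ℝ :=
  (Matrix.toEuclideanLin A).singularValues (n - k)

/-! Let W be a space of r vectors' dimension orthogonal to the n-2r largest right singular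
directions and supported on the first n-r coordinates. If P projects onto W, the diagonal entries of
P sum to r, and Pe_j, rescaled to have j-th entry 1, shows that a column distance squared is at most
σ_{2r}² / P_jj. Summing over j gives `mul_le_sq_ascSingularValue`: uniformly large column distances
force σ_{2r} to be large.

A column is independent of the others. With those frozen, its distance to their span dominates the
length of the projection of its centered part onto r directions orthogonal to them and to its mean.
That squared length has expectation at least cr, and `integral_exp_neg_quadForm_le` with Markov
gives the tail exp(-δr), with δ of order c/K². A union bound costs a factor n, negligible when r ≥
log⁴ n. -/

section

open MeasureTheory ProbabilityTheory
open scoped InnerProductSpace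

/-! ### Laplace transforms of quadratic forms -/

/-- One-variable Laplace bound for a bounded centered variable in a quadratic polynomial. -/
theorem integral_exp_neg_quadratic_le (ν : Measure ℝ) [IsProbabilityMeasure ν] {K c lam m b : ℝ}
    (hlam : lam * K ^ 2 = 1 / 8) (hlam0 : 0 ≤ lam) (hm0 : 0 ≤ m) (hm1 : m ≤ 1)
    (hb : ∀ᵐ x ∂ν, |x| ≤ K) (hmean : ∫ x, x ∂ν = 0) (hvar : c ≤ ∫ x, x ^ 2 ∂ν) :
    ∫ x, Real.exp (-lam * (m * x ^ 2 + 2 * b * x)) ∂ν ≤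
      Real.exp (-(3 / 4) * lam * c * m + lam * b ^ 2 / 2) := by
  have hIcc : ∀ᵐ x ∂ν, id x ∈ Set.Icc (-K) K := by
    filter_upwards [hb] with x hx using ⟨(abs_le.mp hx).1, (abs_le.mp hx).2⟩
  have hsub := hasSubgaussianMGF_of_mem_Icc_of_integral_eq_zero (μ := ν) (X := id)
    aemeasurable_id hIcc hmean
  -- Twice the linear coefficient, since AM-GM below squares each factor; Hoeffding then gives
  -- exactly `B ^ 2` because `lam * K ^ 2 = 1 / 8`.
  set t : ℝ := -(4 * lam * b) with ht
  set B : ℝ := Real.exp (lam * b ^ 2 / 2) with hB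
  set D : ℝ := Real.exp (-(3 / 4) * lam * c * m) with hD
  have hBpos : 0 < B := Real.exp_pos _
  have hDpos : 0 < D := Real.exp_pos _
  have hpint : Integrable (fun x : ℝ => Real.exp (t * x)) ν := hsub.integrable_exp_mul t
  have h1 : ∫ x, Real.exp (t * x) ∂ν ≤ B ^ 2 := by
    have h := hsub.mgf_le t
    rw [mgf] at h
    refine h.trans (le_of_eq ?_)
    rw [hB, ← Real.exp_nat_mul]
    congr 1
    have : |K + K| ^ 2 = 4 * K ^ 2 := by rw [sq_abs]; ring
    simp only [NNReal.coe_pow, NNReal.coe_div, coe_nnnorm, Real.norm_eq_abs, sub_neg_eq_add,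
      NNReal.coe_ofNat, div_pow, this, ht]
    push_cast
    linear_combination (8 * lam * b ^ 2) * hlam
  have hsqint : Integrable (fun x : ℝ => x ^ 2) ν := by
    refine Integrable.of_bound (C := K ^ 2) (by fun_prop) ?_
    filter_upwards [hb] with x hx
    rw [Real.norm_eq_abs, abs_pow]
    exact pow_le_pow_left₀ (abs_nonneg _) hx 2
  have hqint : Integrable (fun x : ℝ => Real.exp (-(2 * lam * m * x ^ 2))) ν := by
    refine Integrable.of_bound (C := 1) (by fun_prop) (.of_forall fun x => ?_)
    rw [Real.norm_eq_abs, Real.abs_exp]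
    exact Real.exp_le_one_iff.mpr (neg_nonpos.mpr (by positivity))
  have h2 : ∫ x, Real.exp (-(2 * lam * m * x ^ 2)) ∂ν ≤ D ^ 2 := by
    calc ∫ x, Real.exp (-(2 * lam * m * x ^ 2)) ∂ν
        ≤ ∫ x, (1 - 3 / 2 * lam * m * x ^ 2) ∂ν := by
          refine integral_mono_ae hqint ((integrable_const _).sub (hsqint.const_mul _)) ?_
          filter_upwards [hb] with x hx
          have hx2 : x ^ 2 ≤ K ^ 2 := by
            rw [← sq_abs x]; exact pow_le_pow_left₀ (abs_nonneg _) hx 2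
          have hy0 : 0 ≤ 2 * lam * m * x ^ 2 := by positivity
          have hy : 2 * lam * m * x ^ 2 ≤ 1 / 4 := by
            have h1 : lam * x ^ 2 ≤ 1 / 8 := hlam ▸ mul_le_mul_of_nonneg_left hx2 hlam0
            have h2 : m * (lam * x ^ 2) ≤ 1 * (lam * x ^ 2) :=
              mul_le_mul_of_nonneg_right hm1 (by positivity)
            linarith
          -- For 0 ≤ y ≤ 1/4, exp(-y) ≤ 1 - y + y² ≤ 1 - 3y/4.
          have := (abs_le.mp (Real.abs_exp_sub_one_sub_id_le (x := -(2 * lam * m * x ^ 2))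
            (by rw [abs_neg, abs_of_nonneg hy0]; linarith))).2
          nlinarith
      _ = 1 - 3 / 2 * lam * m * ∫ x, x ^ 2 ∂ν := by
          rw [integral_sub (integrable_const _) (hsqint.const_mul _), integral_const_mul]
          simp
      _ ≤ 1 - 3 / 2 * lam * m * c := by
          have := mul_le_mul_of_nonneg_left hvar (show 0 ≤ 3 / 2 * lam * m by positivity)
          linarith
      _ ≤ D ^ 2 := by
          rw [hD, ← Real.exp_nat_mul]
          refine le_trans ?_ (Real.add_one_le_exp _)
          push_cast
          linarith
  calc ∫ x, Real.exp (-lam * (m * x ^ 2 + 2 * b * x)) ∂ν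
      ≤ ∫ x, (D / (2 * B) * Real.exp (t * x)
          + B / (2 * D) * Real.exp (-(2 * lam * m * x ^ 2))) ∂ν := by
        refine integral_mono_of_nonneg (.of_forall fun x => (Real.exp_pos _).le)
          ((hpint.const_mul _).add (hqint.const_mul _))
          (.of_forall fun x => ?_)
        simp only
        have e1 : Real.exp (t * x) = Real.exp (-(2 * lam * b) * x) ^ 2 := by
          rw [← Real.exp_nat_mul]; congr 1; rw [ht]; push_cast; ring
        have e2 : Real.exp (-(2 * lam * m * x ^ 2)) = Real.exp (-(lam * m * x ^ 2)) ^ 2 := by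
          rw [← Real.exp_nat_mul]; congr 1; push_cast; ring
        have e3 : Real.exp (-lam * (m * x ^ 2 + 2 * b * x)) =
            Real.exp (-(2 * lam * b) * x) * Real.exp (-(lam * m * x ^ 2)) := by
          rw [← Real.exp_add]; congr 1; ring
        rw [e1, e2, e3]
        set p := Real.exp (-(2 * lam * b) * x)
        set q := Real.exp (-(lam * m * x ^ 2))
        have : D / (2 * B) * p ^ 2 + B / (2 * D) * q ^ 2 - p * q =
            (D * p - B * q) ^ 2 / (2 * B * D) := by
          field_simp; ring
        have h0 : 0 ≤ (D * p - B * q) ^ 2 / (2 * B * D) := by positivity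
        linarith
    _ = D / (2 * B) * ∫ x, Real.exp (t * x) ∂ν
          + B / (2 * D) * ∫ x, Real.exp (-(2 * lam * m * x ^ 2)) ∂ν := by
        rw [integral_add (hpint.const_mul _) (hqint.const_mul _),
          integral_const_mul, integral_const_mul]
    _ ≤ D / (2 * B) * B ^ 2 + B / (2 * D) * D ^ 2 := by gcongr
    _ = D * B := by field_simp; ring
    _ = _ := by rw [hD, hB, ← Real.exp_add]

/-- Laplace transform bound for a contraction quadratic form in independent bounded centered
variables. -/
theorem integral_exp_neg_quadForm_le {K c lam : ℝ} (hlam : lam * K ^ 2 = 1 / 8) (hlam0 : 0 ≤ lam)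
    (hc : 0 ≤ c) (n : ℕ) (ν : Fin n → Measure ℝ) [∀ i, IsProbabilityMeasure (ν i)]
    (hb : ∀ i, ∀ᵐ x ∂ν i, |x| ≤ K) (hmean : ∀ i, ∫ x, x ∂ν i = 0)
    (hvar : ∀ i, c ≤ ∫ x, x ^ 2 ∂ν i) (M : Fin n → Fin n → ℝ) (hsymm : ∀ i j, M i j = M j i)
    (hpos : ∀ x : Fin n → ℝ, 0 ≤ ∑ i, ∑ j, M i j * x i * x j)
    (hle : ∀ x : Fin n → ℝ, ∑ i, ∑ j, M i j * x i * x j ≤ ∑ i, x i ^ 2) :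
    ∫ x, Real.exp (-lam * ∑ i, ∑ j, M i j * x i * x j) ∂(Measure.pi ν) ≤
      Real.exp (-lam * c / 2 * ∑ i, M i i) := by
  induction n with
  | zero => simp
  | succ n ih =>
    set m : ℝ := M 0 0 with hm
    set b : Fin n → ℝ := fun j => M 0 j.succ with hbdef
    set R : (Fin n → ℝ) → ℝ := fun y => ∑ i, ∑ j, M i.succ j.succ * y i * y j with hR
    -- Integrating out the first coordinate costs exp(lam·(b·y)²/2), absorbed into the remaining
    -- form. It stays a nonnegative contraction because (b·y)² ≤ m R(y) and m ≤ 1.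
    set M' : Fin n → Fin n → ℝ := fun i j => M i.succ j.succ - b i * b j / 2 with hM'
    have hsplit : ∀ (x : ℝ) (y : Fin n → ℝ),
        ∑ i, ∑ j, M i j * (Fin.cons x y : Fin (n + 1) → ℝ) i * (Fin.cons x y : Fin (n + 1) → ℝ) j
          = m * x ^ 2 + 2 * (∑ j, b j * y j) * x + R y := by
      intro x y
      simp only [Fin.sum_univ_succ, Fin.cons_zero, Fin.cons_succ, Finset.sum_add_distrib]
      have h1 : ∑ j : Fin n, M 0 j.succ * x * y j = (∑ j, b j * y j) * x := by
        rw [Finset.sum_mul]; exact Finset.sum_congr rfl fun j _ => by rw [hbdef]; ring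
      have h2 : ∑ j : Fin n, M j.succ 0 * y j * x = (∑ j, b j * y j) * x := by
        rw [Finset.sum_mul]
        exact Finset.sum_congr rfl fun j _ => by rw [hbdef, hsymm j.succ 0]
      rw [h1, h2, hm, hR]; ring
    have hm0 : 0 ≤ m := by
      have := hpos (Fin.cons 1 0)
      rw [hsplit] at this
      simpa [hR] using this
    have hm1 : m ≤ 1 := by
      have := hle (Fin.cons 1 0)
      rw [hsplit] at this
      simpa [hR, Fin.sum_univ_succ] using this
    have hRle : ∀ y, R y ≤ ∑ i, y i ^ 2 := by
      intro y
      have := hle (Fin.cons 0 y)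
      rw [hsplit] at this
      simpa [Fin.sum_univ_succ] using this
    have hcs : ∀ y, (∑ j, b j * y j) ^ 2 ≤ m * R y := by
      intro y
      have h := discrim_le_zero (a := m) (b := 2 * ∑ j, b j * y j) (c := R y) (fun x => by
        have := hpos (Fin.cons x y)
        rw [hsplit] at this
        linarith)
      rw [discrim] at h
      linarith
    have hR0 : ∀ y, 0 ≤ R y := by
      intro y
      have := hpos (Fin.cons 0 y)
      rw [hsplit] at this
      simpa using this
    -- Test (b·y)² ≤ m R(y) ≤ m|y|² at y = b.
    have hbb : ∑ j, b j ^ 2 ≤ m := by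
      have h1 := hcs b
      have h2 := hRle b
      have h0 : 0 ≤ ∑ j, b j ^ 2 := Finset.sum_nonneg fun _ _ => sq_nonneg _
      have h3 : ∑ j, b j * b j = ∑ j, b j ^ 2 := Finset.sum_congr rfl fun _ _ => (sq _).symm
      rw [h3] at h1
      by_contra hlt
      push Not at hlt
      nlinarith [mul_le_mul_of_nonneg_left h2 hm0]
    have hM'q : ∀ y : Fin n → ℝ, ∑ i, ∑ j, M' i j * y i * y j =
        R y - (∑ j, b j * y j) ^ 2 / 2 := by
      intro y
      rw [hR, sq, Finset.sum_mul_sum]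
      simp only [Finset.sum_div, ← Finset.sum_sub_distrib]
      refine Finset.sum_congr rfl fun i _ => Finset.sum_congr rfl fun j _ => ?_
      rw [hM']; ring
    have hind := ih (fun i => ν i.succ) (fun i => hb _) (fun i => hmean _) (fun i => hvar _) M'
      (fun i j => by simp only [hM']; rw [hsymm]; ring)
      (fun y => by
        rw [hM'q]
        have := hcs y
        have := mul_le_mul_of_nonneg_right hm1 (hR0 y)
        have := hR0 y
        linarith)
      (fun y => by
        rw [hM'q]
        have := hRle y
        have := sq_nonneg (∑ j, b j * y j)
        linarith)
    have htr : ∑ i, M' i i = ∑ i : Fin n, M i.succ i.succ - (∑ j, b j ^ 2) / 2 := by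
      rw [Finset.sum_div, ← Finset.sum_sub_distrib]
      exact Finset.sum_congr rfl fun i _ => by simp only [hM']; ring
    have hM'pos : ∀ y : Fin n → ℝ, 0 ≤ ∑ i, ∑ j, M' i j * y i * y j := fun y => by
      rw [hM'q]
      have := hcs y
      have := mul_le_mul_of_nonneg_right hm1 (hR0 y)
      have := hR0 y
      linarith
    rw [← ((measurePreserving_piFinSuccAbove ν 0).symm).integral_comp']
    simp_rw [MeasurableEquiv.piFinSuccAbove_symm_apply, Fin.insertNthEquiv, Equiv.coe_fn_mk,
      Fin.insertNth_zero']
    simp only [Fin.zero_succAbove]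
    have hint : Integrable (fun z : ℝ × (Fin n → ℝ) => Real.exp (-lam *
        ∑ i, ∑ j, M i j * (Fin.cons z.1 z.2 : Fin (n + 1) → ℝ) i *
          (Fin.cons z.1 z.2 : Fin (n + 1) → ℝ) j))
        ((ν 0).prod (Measure.pi fun j => ν j.succ)) := by
      refine Integrable.of_bound (C := 1) ?_ (.of_forall fun z => ?_)
      · simp_rw [hsplit, hR]
        exact Measurable.aestronglyMeasurable (by fun_prop)
      · rw [Real.norm_eq_abs, Real.abs_exp, Real.exp_le_one_iff, neg_mul]
        exact neg_nonpos.mpr (mul_nonneg hlam0 (hpos _))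
    rw [integral_prod_symm _ hint]
    calc ∫ y, ∫ x, Real.exp (-lam * ∑ i, ∑ j, M i j * (Fin.cons x y : Fin (n + 1) → ℝ) i *
          (Fin.cons x y : Fin (n + 1) → ℝ) j) ∂ν 0 ∂(Measure.pi fun j => ν j.succ)
        ≤ ∫ y, Real.exp (-(3 / 4) * lam * c * m) *
            Real.exp (-lam * ∑ i, ∑ j, M' i j * y i * y j) ∂(Measure.pi fun j => ν j.succ) := by
          refine integral_mono_of_nonneg
            (.of_forall fun y => integral_nonneg fun x => (Real.exp_pos _).le)
            (Integrable.const_mul (Integrable.of_bound (C := 1)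
              (Measurable.aestronglyMeasurable (by fun_prop)) (.of_forall fun y => ?_)) _)
            (.of_forall fun y => ?_)
          · rw [Real.norm_eq_abs, Real.abs_exp, Real.exp_le_one_iff, neg_mul]
            exact neg_nonpos.mpr (mul_nonneg hlam0 (hM'pos _))
          · simp only [hsplit]
            have h := integral_exp_neg_quadratic_le (ν 0) (b := ∑ j, b j * y j) hlam hlam0 hm0 hm1
              (hb 0) (hmean 0) (hvar 0)
            have e : ∀ x, Real.exp (-lam * (m * x ^ 2 + 2 * (∑ j, b j * y j) * x + R y)) =
                Real.exp (-lam * (m * x ^ 2 + 2 * (∑ j, b j * y j) * x)) *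
                  Real.exp (-lam * R y) := fun x => by
              rw [← Real.exp_add]; congr 1; ring
            simp_rw [e]
            rw [integral_mul_const]
            refine (mul_le_mul_of_nonneg_right h (Real.exp_pos _).le).trans (le_of_eq ?_)
            rw [← Real.exp_add, ← Real.exp_add, hM'q]
            congr 1; ring
      _ ≤ Real.exp (-(3 / 4) * lam * c * m) * Real.exp (-lam * c / 2 * ∑ i, M' i i) := by
          rw [integral_const_mul]
          exact mul_le_mul_of_nonneg_left hind (Real.exp_pos _).le
      _ ≤ _ := by
          -- The one-variable rate 3/4 pays 1/2 for the diagonal entry m and 1/4 for the trace lost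
          -- to |b|²/2 ≤ m/2.
          rw [← Real.exp_add, htr, Fin.sum_univ_succ]
          refine Real.exp_le_exp.mpr ?_
          have := mul_le_mul_of_nonneg_left hbb (mul_nonneg hlam0 hc)
          nlinarith

/-! ### Projections onto r directions and their lower tail -/

theorem exists_orthonormal_orthogonal {E ι : Type*} [NormedAddCommGroup E] [InnerProductSpace ℝ E]
    [FiniteDimensional ℝ E] [Fintype ι] (z : ι → E) {r : ℕ}
    (h : Fintype.card ι + r ≤ Module.finrank ℝ E) :
    ∃ w : Fin r → E, Orthonormal ℝ w ∧ ∀ i k, ⟪z i, w k⟫_ℝ = 0 := by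
  set S : Submodule ℝ E := Submodule.span ℝ (Set.range z) with hS
  have h1 : Module.finrank ℝ S ≤ Fintype.card ι := finrank_range_le_card z
  have h2 := S.finrank_add_finrank_orthogonal
  have h3 : r ≤ Module.finrank ℝ Sᗮ := by omega
  refine ⟨fun k => (stdOrthonormalBasis ℝ Sᗮ (Fin.castLE h3 k) : E), ?_, fun i k => ?_⟩
  · exact ((stdOrthonormalBasis ℝ Sᗮ).orthonormal.comp_linearIsometry Sᗮ.subtypeₗᵢ).comp _
      (Fin.castLE_injective h3)
  · exact (Submodule.mem_orthogonal S _).mp (SetLike.coe_mem _) _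
      (Submodule.subset_span (Set.mem_range_self i))

theorem EuclideanSpace.real_inner_eq_sum {n : ℕ} (x y : EuclideanSpace ℝ (Fin n)) :
    ⟪x, y⟫_ℝ = ∑ i, x i * y i := by
  rw [PiLp.inner_apply]
  exact Finset.sum_congr rfl fun i _ => by simp [mul_comm]

/-- Lower tail of the squared length of an orthogonal projection of a random vector with
independent bounded centered coordinates. -/
theorem measureReal_sum_sq_lt_le {K c lam : ℝ} (hlam : lam * K ^ 2 = 1 / 8) (hlam0 : 0 ≤ lam)
    (hc : 0 ≤ c) {n r : ℕ} (ν : Fin n → Measure ℝ) [∀ i, IsProbabilityMeasure (ν i)]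
    (hb : ∀ i, ∀ᵐ x ∂ν i, |x| ≤ K) (hmean : ∀ i, ∫ x, x ∂ν i = 0)
    (hvar : ∀ i, c ≤ ∫ x, x ^ 2 ∂ν i) (w : Fin r → EuclideanSpace ℝ (Fin n))
    (hw : Orthonormal ℝ w) :
    (Measure.pi ν).real {x | ∑ k, (∑ i, w k i * x i) ^ 2 ≤ c * r / 4} ≤
      Real.exp (-(lam * c / 4 * r)) := by
  have hq : ∀ x : Fin n → ℝ, ∑ i, ∑ j, (∑ k, w k i * w k j) * x i * x j =
      ∑ k, (∑ i, w k i * x i) ^ 2 := by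
    intro x
    simp only [sq, Finset.sum_mul_sum]
    symm
    rw [Finset.sum_comm]
    refine Finset.sum_congr rfl fun i _ => ?_
    rw [Finset.sum_comm]
    refine Finset.sum_congr rfl fun j _ => ?_
    rw [Finset.sum_mul, Finset.sum_mul]
    exact Finset.sum_congr rfl fun k _ => by ring
  have htr : ∑ i, ∑ k, w k i * w k i = (r : ℝ) := by
    rw [Finset.sum_comm]
    have : ∀ k, ∑ i, w k i * w k i = 1 := fun k => by
      rw [← EuclideanSpace.real_inner_eq_sum, real_inner_self_eq_norm_sq, hw.1 k, one_pow]
    simp [this]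
  have hlap := integral_exp_neg_quadForm_le hlam hlam0 hc n ν hb hmean hvar
    (fun i j => ∑ k, w k i * w k j) (fun i j => Finset.sum_congr rfl fun k _ => mul_comm _ _)
    (fun x => by rw [hq]; exact Finset.sum_nonneg fun _ _ => sq_nonneg _)
    (fun x => by
      rw [hq]
      have := hw.sum_inner_products_le (x := WithLp.toLp 2 x) (s := Finset.univ)
      simpa [EuclideanSpace.real_inner_eq_sum, EuclideanSpace.norm_sq_eq] using this)
  rw [htr] at hlap
  simp_rw [hq] at hlap
  have hmarkov := measure_le_le_exp_mul_mgf (μ := Measure.pi ν)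
    (X := fun x : Fin n → ℝ => ∑ k, (∑ i, w k i * x i) ^ 2) (t := -lam) (c * r / 4)
    (neg_nonpos.mpr hlam0) (Integrable.of_bound (C := 1)
      (Measurable.aestronglyMeasurable (by fun_prop)) (.of_forall fun y => by
        rw [Real.norm_eq_abs, Real.abs_exp, Real.exp_le_one_iff, neg_mul]
        exact neg_nonpos.mpr (mul_nonneg hlam0 (Finset.sum_nonneg fun _ _ => sq_nonneg _))))
  refine hmarkov.trans ((mul_le_mul_of_nonneg_left hlap (Real.exp_pos _).le).trans (le_of_eq ?_))
  rw [← Real.exp_add]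
  congr 1; ring

/-! ### Deterministic bound: column distances control singular values -/

/-- If each of the first `n - r` columns is at squared distance at least `τ` from the span of the
other ones, then the `2r`-th smallest singular value is bounded below. -/
theorem mul_le_sq_ascSingularValue {n r : ℕ} (hr : 1 ≤ r) (h2r : 2 * r ≤ n)
    (A : Matrix (Fin n) (Fin n) ℝ) {τ : ℝ}
    (hdist : ∀ j : Fin n, (j : ℕ) < n - r → ∀ v : Fin n → ℝ, v j = 1 →
      (∀ k : Fin n, n - r ≤ (k : ℕ) → v k = 0) → τ ≤ ∑ i, (A.mulVec v i) ^ 2) :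
    τ * r ≤ ((n : ℝ) - r) * ascSingularValue A (2 * r) ^ 2 := by
  set T := Matrix.toEuclideanLin A with hT
  have hn : Module.finrank ℝ (EuclideanSpace ℝ (Fin n)) = n := by simp
  have hsym := T.isSymmetric_adjoint_comp_self
  set u := hsym.eigenvectorBasis hn with hu
  set ev := hsym.eigenvalues hn with hev
  have hlt : n - 2 * r < n := by omega
  set s2 : ℝ := ascSingularValue A (2 * r) ^ 2 with hs2
  have hσ : s2 = ev ⟨n - 2 * r, hlt⟩ := by
    rw [hs2, ascSingularValue]
    exact T.sq_singularValues_of_lt hn hlt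
  have hs20 : 0 ≤ s2 := sq_nonneg _
  -- There are (n-2r) + r = n-r constraints, which leaves r dimensions.
  obtain ⟨w, hw, hwz⟩ := exists_orthonormal_orthogonal (r := r)
    (Sum.elim (fun i : Fin (n - 2 * r) => u ⟨i, by omega⟩)
      (fun k : Fin r => EuclideanSpace.single (⟨n - r + k, by omega⟩ : Fin n) (1 : ℝ)))
    (by simp; omega)
  have hwu : ∀ (i : Fin n) k, (i : ℕ) < n - 2 * r → ⟪u i, w k⟫_ℝ = 0 := fun i k hi => by
    simpa using hwz (Sum.inl ⟨i, hi⟩) k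
  have hw0 : ∀ (i : Fin n) k, n - r ≤ (i : ℕ) → w k i = 0 := fun i k hi => by
    have := hwz (Sum.inr ⟨i - (n - r), by omega⟩) k
    have e : (⟨n - r + (i - (n - r)), by omega⟩ : Fin n) = i := Fin.ext (by simp; omega)
    simpa [e, EuclideanSpace.inner_single_left] using this
  have hTle : ∀ v : EuclideanSpace ℝ (Fin n),
      (∀ i : Fin n, (i : ℕ) < n - 2 * r → ⟪u i, v⟫_ℝ = 0) → ‖T v‖ ^ 2 ≤ s2 * ‖v‖ ^ 2 := by
    intro v hv
    have h1 : ‖T v‖ ^ 2 = ∑ i, ev i * ⟪u i, v⟫_ℝ ^ 2 := by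
      rw [← real_inner_self_eq_norm_sq, ← LinearMap.adjoint_inner_left, ← LinearMap.comp_apply,
        ← u.sum_inner_mul_inner]
      refine Finset.sum_congr rfl fun i _ => ?_
      rw [hsym v (u i), hsym.apply_eigenvectorBasis hn i]
      simp only [real_inner_smul_right, real_inner_comm]
      simp [hev, hu, sq, mul_assoc]
    have h2 : ‖v‖ ^ 2 = ∑ i, ⟪u i, v⟫_ℝ ^ 2 := by
      rw [← real_inner_self_eq_norm_sq, ← u.sum_inner_mul_inner]
      exact Finset.sum_congr rfl fun i _ => by rw [sq, real_inner_comm v (u i)]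
    rw [h1, h2, Finset.mul_sum]
    refine Finset.sum_le_sum fun i _ => ?_
    by_cases hi : (i : ℕ) < n - 2 * r
    · simp [hv i hi]
    · refine mul_le_mul_of_nonneg_right ?_ (sq_nonneg _)
      rw [hσ]
      exact hsym.eigenvalues_antitone hn (Fin.mk_le_of_le_val (by omega))
  set q : Fin n → ℝ := fun j => ∑ k, w k j ^ 2 with hq
  have hqsum : ∑ j, q j = r := by
    rw [hq, Finset.sum_comm]
    have : ∀ k, ∑ i, w k i ^ 2 = 1 := fun k => by
      have := EuclideanSpace.real_norm_sq_eq (w k)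
      rw [← this, hw.1 k, one_pow]
    simp [this]
  have hkey : ∀ j : Fin n, (j : ℕ) < n - r → τ * q j ≤ s2 := by
    intro j hj
    have hq0 : 0 ≤ q j := Finset.sum_nonneg fun _ _ => sq_nonneg _
    rcases hq0.eq_or_lt with h0 | hpos
    · rw [← h0]; simpa using hs20
    -- The projection of e_j onto the span of `w`: its j-th entry and its squared norm are both `q
    -- j`.
    set p : EuclideanSpace ℝ (Fin n) := ∑ k, w k j • w k with hp
    have hpi : ∀ i, p i = ∑ k, w k j * w k i := fun i => by simp [hp]
    have hpj : p j = q j := by rw [hpi]; exact Finset.sum_congr rfl fun k _ => (sq _).symm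
    have hpn : ‖p‖ ^ 2 = q j := by
      rw [← real_inner_self_eq_norm_sq, hp, hw.inner_sum]
      exact Finset.sum_congr rfl fun k _ => by simp [sq]
    have hT1 := hTle p (fun i hi => by
      rw [hp, inner_sum]
      exact Finset.sum_eq_zero fun k _ => by rw [real_inner_smul_right, hwu i k hi, mul_zero])
    have hd := hdist j hj (fun i => (q j)⁻¹ * p i)
      (by simp only [hpj]; exact inv_mul_cancel₀ hpos.ne')
      (fun k hk => by
        rw [hpi]
        simp [hw0 k _ hk])
    have hTn : ∑ i, (A.mulVec (fun i => (q j)⁻¹ * p i) i) ^ 2 = ((q j)⁻¹) ^ 2 * ‖T p‖ ^ 2 := by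
      rw [EuclideanSpace.real_norm_sq_eq, Finset.mul_sum]
      have : (fun i => (q j)⁻¹ * p i) = (q j)⁻¹ • (WithLp.ofLp p) := rfl
      rw [this, Matrix.mulVec_smul]
      refine Finset.sum_congr rfl fun i _ => ?_
      simp [hT, Matrix.toLpLin_apply, mul_pow]
    rw [hTn] at hd
    rw [hpn] at hT1
    have h1 : τ ≤ (q j)⁻¹ ^ 2 * (s2 * q j) :=
      hd.trans (mul_le_mul_of_nonneg_left hT1 (sq_nonneg _))
    calc τ * q j ≤ (q j)⁻¹ ^ 2 * (s2 * q j) * q j := mul_le_mul_of_nonneg_right h1 hq0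
      _ = s2 := by field_simp
  have hfilter : ∑ j, q j = ∑ j ∈ Finset.univ.filter (fun j : Fin n => (j : ℕ) < n - r), q j := by
    symm
    refine Finset.sum_filter_of_ne fun j _ hne => ?_
    by_contra hj
    exact hne (Finset.sum_eq_zero fun k _ => by rw [hw0 j k (by omega)]; simp)
  have hcard : (Finset.univ.filter (fun j : Fin n => (j : ℕ) < n - r)).card = n - r := by
    rw [Fin.card_filter_val_lt]; omega
  calc τ * r = ∑ j ∈ Finset.univ.filter (fun j : Fin n => (j : ℕ) < n - r), τ * q j := by
        rw [← Finset.mul_sum, ← hfilter, hqsum]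
    _ ≤ ∑ j ∈ Finset.univ.filter (fun j : Fin n => (j : ℕ) < n - r), s2 :=
        Finset.sum_le_sum fun j hj => hkey j (Finset.mem_filter.mp hj).2
    _ = ((n : ℝ) - r) * s2 := by
        rw [Finset.sum_const, hcard, nsmul_eq_mul, Nat.cast_sub (by omega)]

/-! ### Distance from a random column to the span of the others -/

/-- The set of pairs `(x, y)` such that the shifted column `x + e` is at squared distance less than
`τ` from the span of the columns of `y` with index `k < m`, `k ≠ j`. -/
def nearSpanSet {n : ℕ} (e : Fin n → ℝ) (j : Fin n) (m : ℕ) (τ : ℝ) :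
    Set ((Fin n → ℝ) × (Fin n → Fin n → ℝ)) :=
  {p | ∃ v : Fin n → ℝ, v j = 1 ∧ (∀ k : Fin n, m ≤ (k : ℕ) → v k = 0) ∧
    ∑ i, (∑ k, (if k = j then p.1 i + e i else p.2 i k) * v k) ^ 2 < τ}

/-- Openness supplies measurability, which is not immediate from an uncountable union over `v`. -/
theorem isOpen_nearSpanSet {n : ℕ} (e : Fin n → ℝ) (j : Fin n) (m : ℕ) (τ : ℝ) :
    IsOpen (nearSpanSet e j m τ) := by
  have : nearSpanSet e j m τ = ⋃ v ∈ {v : Fin n → ℝ | v j = 1 ∧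
      ∀ k : Fin n, m ≤ (k : ℕ) → v k = 0}, {p : (Fin n → ℝ) × (Fin n → Fin n → ℝ) |
      ∑ i, (∑ k, (if k = j then p.1 i + e i else p.2 i k) * v k) ^ 2 < τ} := by
    ext p
    simp [nearSpanSet, and_assoc]
  rw [this]
  refine isOpen_biUnion fun v _ => isOpen_lt ?_ continuous_const
  refine continuous_finsetSum _ fun i _ => (continuous_finsetSum _ fun k _ => ?_).pow 2
  refine Continuous.mul ?_ continuous_const
  split_ifs <;> fun_prop

/-- The directions `w` depend on `y` only. They annihilate the other columns and the mean `e`, so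
they see only `x` in the combination, and Bessel's inequality applies. -/
theorem exists_orthonormal_sum_sq_lt {n r : ℕ} (h2r : r ≤ n) (e : Fin n → ℝ) (j : Fin n)
    (hj : (j : ℕ) < n - r) (τ : ℝ) (y : Fin n → Fin n → ℝ) :
    ∃ w : Fin r → EuclideanSpace ℝ (Fin n), Orthonormal ℝ w ∧
      (fun x => (x, y)) ⁻¹' nearSpanSet e j (n - r) τ ⊆
        {x | ∑ k, (∑ i, w k i * x i) ^ 2 ≤ τ} := by
  obtain ⟨w, hw, hwz⟩ := exists_orthonormal_orthogonal (r := r)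
    -- The mean takes the slot of column j, so there are exactly n-r constraints.
    (fun k : Fin (n - r) => (WithLp.toLp 2 (if (k : ℕ) = j then e else
      fun i => y i ⟨k, by omega⟩) : EuclideanSpace ℝ (Fin n)))
    (by simp; omega)
  refine ⟨w, hw, ?_⟩
  rintro x ⟨v, hvj, hv0, hv⟩
  have hwe : ∀ k, ∑ i, w k i * e i = 0 := fun k => by
    have := hwz ⟨j, hj⟩ k
    rw [real_inner_comm, EuclideanSpace.real_inner_eq_sum] at this
    simpa using this
  have hwy : ∀ k (l : Fin n), l ≠ j → (l : ℕ) < n - r → ∑ i, w k i * y i l = 0 := by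
    intro k l hl hlr
    have := hwz ⟨l, hlr⟩ k
    rw [real_inner_comm, EuclideanSpace.real_inner_eq_sum] at this
    simpa [Fin.val_ne_of_ne hl] using this
  set g : Fin n → ℝ := fun i => ∑ k, (if k = j then x i + e i else y i k) * v k with hg
  have hwg : ∀ k, ∑ i, w k i * g i = ∑ i, w k i * x i := by
    intro k
    have h1 : ∑ i, w k i * g i =
        ∑ l, (∑ i, w k i * (if l = j then x i + e i else y i l)) * v l := by
      simp only [hg, Finset.mul_sum, Finset.sum_mul]
      rw [Finset.sum_comm]
      exact Finset.sum_congr rfl fun l _ => Finset.sum_congr rfl fun i _ => by ring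
    rw [h1, Finset.sum_eq_single j]
    · simp [hvj, mul_add, Finset.sum_add_distrib, hwe]
    · intro l _ hl
      by_cases hlr : (l : ℕ) < n - r
      · simp [hl, hwy k l hl hlr]
      · rw [hv0 l (by omega), mul_zero]
    · simp
  have hbes := hw.sum_inner_products_le (x := WithLp.toLp 2 g) (s := Finset.univ)
  simp only [EuclideanSpace.real_inner_eq_sum, Real.norm_eq_abs, sq_abs,
    EuclideanSpace.real_norm_sq_eq, hwg] at hbes
  exact hbes.trans hv.le

theorem indepFun_column_other_columns {n : ℕ} {Ω : Type*} [MeasurableSpace Ω] (μ : Measure Ω)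
    (a : Fin n → Fin n → Ω → ℝ) (hmeas : ∀ i j, Measurable (a i j))
    (hind : iIndepFun (fun (p : Fin n × Fin n) => a p.1 p.2) μ) (e : Fin n → ℝ) (j : Fin n) :
    IndepFun (fun ω i => a i j ω - e i) (fun ω i k => if k = j then 0 else a i k ω) μ := by
  obtain ⟨S, hS⟩ : ∃ S : Finset (Fin n × Fin n), ∀ p, p ∈ S ↔ p.2 = j :=
    ⟨Finset.univ.filter fun p => p.2 = j, by simp⟩
  obtain ⟨T, hT⟩ : ∃ T : Finset (Fin n × Fin n), ∀ p, p ∈ T ↔ p.2 ≠ j :=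
    ⟨Finset.univ.filter fun p => p.2 ≠ j, by simp⟩
  have hST : Disjoint S T :=
    Finset.disjoint_left.mpr fun p hp hp' => (hT p).mp hp' ((hS p).mp hp)
  have h := hind.indepFun_finset S T hST fun p => hmeas p.1 p.2
  set φ : (S → ℝ) → Fin n → ℝ := fun x i => x ⟨(i, j), (hS _).mpr rfl⟩ - e i with hφ
  set ψ : (T → ℝ) → Fin n → Fin n → ℝ := fun x i k =>
    if hk : k = j then 0 else x ⟨(i, k), (hT _).mpr hk⟩ with hψ
  have hφm : Measurable φ := measurable_pi_lambda _ fun i => (measurable_pi_apply _).sub_const _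
  have hψm : Measurable ψ := by
    refine measurable_pi_lambda _ fun i => measurable_pi_lambda _ fun k => ?_
    by_cases hk : k = j
    · simp only [hψ, dif_pos hk]; exact measurable_const
    · simp only [hψ, dif_neg hk]; exact measurable_pi_apply _
  have hY : (fun ω i k => if k = j then 0 else a i k ω) =
      ψ ∘ fun ω (p : T) => a p.1.1 p.1.2 ω := by
    funext ω i k
    by_cases hk : k = j <;> simp [hψ, hk]
  rw [hY]
  exact h.comp hφm hψm

theorem measureReal_column_near_span_le {K c lam : ℝ} (hlam : lam * K ^ 2 = 1 / 8)
    (hlam0 : 0 ≤ lam) (hc : 0 ≤ c) {n r : ℕ} (hr : r ≤ n) {Ω : Type*} [MeasurableSpace Ω]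
    (μ : Measure Ω) [IsProbabilityMeasure μ] (a : Fin n → Fin n → Ω → ℝ)
    (hmeas : ∀ i j, Measurable (a i j))
    (hind : iIndepFun (fun (p : Fin n × Fin n) => a p.1 p.2) μ)
    (hbound : ∀ i j, ∀ᵐ ω ∂μ, |a i j ω - ∫ ω', a i j ω' ∂μ| ≤ K)
    (hvar : ∀ i j, c ≤ variance (a i j) μ) (j : Fin n) (hj : (j : ℕ) < n - r) :
    μ.real {ω | ∃ v : Fin n → ℝ, v j = 1 ∧ (∀ k : Fin n, n - r ≤ (k : ℕ) → v k = 0) ∧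
      ∑ i, (∑ k, a i k ω * v k) ^ 2 < c * r / 4} ≤ Real.exp (-(lam * c / 4 * r)) := by
  set e : Fin n → ℝ := fun i => ∫ ω, a i j ω ∂μ with he
  set X : Ω → Fin n → ℝ := fun ω i => a i j ω - e i with hX
  -- The zero in column j is a filler that `nearSpanSet` never reads; it makes `Y` independent of
  -- `X`.
  set Y : Ω → Fin n → Fin n → ℝ := fun ω i k => if k = j then 0 else a i k ω with hY
  have hXm : Measurable X := measurable_pi_lambda _ fun i => (hmeas i j).sub_const _
  have hYm : Measurable Y := measurable_pi_lambda _ fun i => measurable_pi_lambda _ fun k => by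
    by_cases hk : k = j
    · simp [hY, hk]
    · simpa [hY, hk] using hmeas i k
  have hXY : IndepFun X Y μ := indepFun_column_other_columns μ a hmeas hind e j
  have hXi : iIndepFun (fun i ω => a i j ω - e i) μ :=
    (hind.precomp (g := fun i : Fin n => (i, j)) (fun i i' h => (Prod.mk.inj h).1)).comp
      (fun i x => x - e i) (fun i => measurable_id.sub_const _)
  set ν : Fin n → Measure ℝ := fun i => μ.map fun ω => a i j ω - e i with hν
  have hXmi : ∀ i, Measurable fun ω => a i j ω - e i := fun i => (hmeas i j).sub_const _
  have hlaw : μ.map X = Measure.pi ν :=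
    (iIndepFun_iff_map_fun_eq_pi_map fun i => (hXmi i).aemeasurable).mp hXi
  have : ∀ i, IsProbabilityMeasure (ν i) := fun i =>
    Measure.isProbabilityMeasure_map (hXmi i).aemeasurable
  have hνb : ∀ i, ∀ᵐ x ∂ν i, |x| ≤ K := fun i => by
    rw [hν, ae_map_iff (hXmi i).aemeasurable (measurableSet_le (by fun_prop) measurable_const)]
    exact hbound i j
  have hint : ∀ i, Integrable (a i j) μ := fun i => by
    have : Integrable (fun ω => a i j ω - e i) μ :=
      Integrable.of_bound (C := K) (hXmi i).aestronglyMeasurable (hbound i j)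
    exact (this.add (integrable_const (e i))).congr (.of_forall fun ω => by simp)
  have hνmean : ∀ i, ∫ x, x ∂ν i = 0 := fun i => by
    rw [hν, integral_map (hXmi i).aemeasurable (by fun_prop),
      integral_sub (hint i) (integrable_const _)]
    simp [he]
  have hνvar : ∀ i, c ≤ ∫ x, x ^ 2 ∂ν i := fun i => by
    rw [hν, integral_map (hXmi i).aemeasurable (by fun_prop),
      ← variance_eq_integral (hmeas i j).aemeasurable]
    exact hvar i j
  set G := nearSpanSet e j (n - r) (c * r / 4) with hG
  have hGm : MeasurableSet G := (isOpen_nearSpanSet _ _ _ _).measurableSet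
  have hset : {ω | ∃ v : Fin n → ℝ, v j = 1 ∧ (∀ k : Fin n, n - r ≤ (k : ℕ) → v k = 0) ∧
      ∑ i, (∑ k, a i k ω * v k) ^ 2 < c * r / 4} = (fun ω => (X ω, Y ω)) ⁻¹' G := by
    have hcol : ∀ (ω : Ω) (i k : Fin n),
        (if k = j then X ω i + e i else Y ω i k) = a i k ω := by
      intro ω i k
      by_cases hk : k = j <;> simp [hX, hY, hk]
    ext ω
    simp only [hG, nearSpanSet, Set.mem_ofPred_eq, Set.mem_preimage, hcol]
  rw [hset, Measure.real, ← Measure.map_apply (hXm.prodMk hYm) hGm,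
    (indepFun_iff_map_prod_eq_prod_map_map hXm.aemeasurable hYm.aemeasurable).mp hXY,
    Measure.prod_apply_symm hGm, hlaw]
  have : IsProbabilityMeasure (μ.map Y) := Measure.isProbabilityMeasure_map hYm.aemeasurable
  refine ENNReal.toReal_le_of_le_ofReal (Real.exp_pos _).le ?_
  -- Fubini over the frozen columns: the tail bound is uniform in the directions chosen for each
  -- `y`.
  calc ∫⁻ y, Measure.pi ν ((fun x => (x, y)) ⁻¹' G) ∂(μ.map Y)
      ≤ ∫⁻ _, ENNReal.ofReal (Real.exp (-(lam * c / 4 * r))) ∂(μ.map Y) := by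
        refine lintegral_mono fun y => ?_
        obtain ⟨w, hw, hsub⟩ := exists_orthonormal_sum_sq_lt hr e j hj (c * r / 4) y
        refine (measure_mono hsub).trans ?_
        rw [← ofReal_measureReal]
        exact ENNReal.ofReal_le_ofReal
          (measureReal_sum_sq_lt_le hlam hlam0 hc ν hνb hνmean hνvar w hw)
    _ = _ := by simp

/-! ### Union bound and asymptotics -/

theorem measureReal_ascSingularValue_le {K c lam : ℝ} (hlam : lam * K ^ 2 = 1 / 8)
    (hlam0 : 0 ≤ lam) (hc : 0 < c) (hc1 : c < 1) {n r : ℕ} (hr : 1 ≤ r) (h2r : 2 * r ≤ n)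
    {Ω : Type*} [MeasurableSpace Ω]
    (μ : Measure Ω) [IsProbabilityMeasure μ] (a : Fin n → Fin n → Ω → ℝ)
    (hmeas : ∀ i j, Measurable (a i j))
    (hind : iIndepFun (fun (p : Fin n × Fin n) => a p.1 p.2) μ)
    (hbound : ∀ i j, ∀ᵐ ω ∂μ, |a i j ω - ∫ ω', a i j ω' ∂μ| ≤ K)
    (hvar : ∀ i j, c ≤ variance (a i j) μ) :
    μ.real {ω | ascSingularValue (Matrix.of fun i j => a i j ω) (2 * r) ≤
      (r : ℝ) * c ^ 2 / (2 * Real.sqrt ((n : ℝ) - (r : ℝ)))} ≤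
      n * Real.exp (-(lam * c / 4 * r)) := by
  set J := Finset.univ.filter fun j : Fin n => (j : ℕ) < n - r with hJ
  set S : Fin n → Set Ω := fun j =>
    {ω | ∃ v : Fin n → ℝ, v j = 1 ∧ (∀ k : Fin n, n - r ≤ (k : ℕ) → v k = 0) ∧
      ∑ i, (∑ k, a i k ω * v k) ^ 2 < c * r / 4} with hS
  have hsub : {ω | ascSingularValue (Matrix.of fun i j => a i j ω) (2 * r) ≤
      (r : ℝ) * c ^ 2 / (2 * Real.sqrt ((n : ℝ) - (r : ℝ)))} ⊆ ⋃ j ∈ J, S j := by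
    intro ω hω
    by_contra hnot
    simp only [Set.mem_iUnion, not_exists] at hnot
    have hlow := mul_le_sq_ascSingularValue hr h2r (Matrix.of fun i j => a i j ω)
      (τ := c * r / 4) (fun j hj v hvj hv0 => by
        by_contra hlt
        exact hnot j (by simp [hJ, hj]) ⟨v, hvj, hv0, not_le.mp hlt⟩)
    have hr1 : (1 : ℝ) ≤ r := by exact_mod_cast hr
    have hnr : (0 : ℝ) < (n : ℝ) - r := by
      have : (2 : ℝ) * r ≤ n := by exact_mod_cast h2r
      linarith
    have h0 : 0 ≤ ascSingularValue (Matrix.of fun i j => a i j ω) (2 * r) :=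
      LinearMap.singularValues_nonneg _ _
    have hup := mul_le_mul_of_nonneg_left (pow_le_pow_left₀ h0 hω 2) hnr.le
    have heq : ((n : ℝ) - r) * ((r : ℝ) * c ^ 2 / (2 * Real.sqrt ((n : ℝ) - (r : ℝ)))) ^ 2 =
        (r : ℝ) ^ 2 * c ^ 4 / 4 := by
      rw [div_pow, mul_pow 2, Real.sq_sqrt hnr.le]
      field_simp
      ring
    rw [heq] at hup
    -- The strict gap handles the non-strict inequality in the event: σ_{2r}² is at least
    -- cr²/(4(n-r)), and the squared threshold has c⁴ in place of c.
    have hc4 : c ^ 4 < c := by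
      have := pow_lt_pow_right_of_lt_one₀ hc hc1 (show 1 < 4 by norm_num)
      simpa using this
    have hr2 : (0 : ℝ) < (r : ℝ) ^ 2 := by positivity
    have := mul_lt_mul_of_pos_left hc4 hr2
    linarith
  calc _ ≤ μ.real (⋃ j ∈ J, S j) := measureReal_mono hsub (measure_ne_top _ _)
    _ ≤ ∑ j ∈ J, μ.real (S j) := measureReal_biUnion_finset_le _ _
    _ ≤ ∑ j ∈ J, Real.exp (-(lam * c / 4 * r)) := Finset.sum_le_sum fun j hj =>
        measureReal_column_near_span_le hlam hlam0 hc.le (by omega) μ a hmeas hind hbound hvar j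
          (Finset.mem_filter.mp hj).2
    _ ≤ n * Real.exp (-(lam * c / 4 * r)) := by
        rw [Finset.sum_const, nsmul_eq_mul]
        refine mul_le_mul_of_nonneg_right ?_ (Real.exp_pos _).le
        exact_mod_cast (Finset.card_le_univ J).trans (by simp)

/-- With L = log n, this compares exp(L - δL⁴) with exp(-L²). -/
theorem mul_exp_neg_log_pow_four_isLittleO {δ : ℝ} (hδ : 0 < δ) :
    (fun n : ℕ => (n : ℝ) * Real.exp (-(δ * Real.log n ^ 4))) =o[Filter.atTop]
      (fun n : ℕ => (n : ℝ) ^ (-Real.log (n : ℝ))) := by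
  have hL : Filter.Tendsto (fun n : ℕ => Real.log (n : ℝ)) Filter.atTop Filter.atTop :=
    Real.tendsto_log_atTop.comp tendsto_natCast_atTop_atTop
  have hmain : (fun n : ℕ => Real.exp (Real.log n - δ * Real.log n ^ 4)) =o[Filter.atTop]
      (fun n : ℕ => Real.exp (-Real.log (n : ℝ) ^ 2)) := by
    rw [Real.isLittleO_exp_comp_exp_comp]
    refine Filter.tendsto_atTop_mono' _ ?_ hL
    filter_upwards [hL.eventually_ge_atTop 1, hL.eventually_ge_atTop (3 / δ)] with n h1 h3
    set x := Real.log (n : ℝ)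
    have h3' : 3 ≤ δ * x := by
      rw [div_le_iff₀ hδ] at h3
      linarith
    have hx3 : 0 ≤ x ^ 3 := by positivity
    have h4 : 3 * x ^ 3 ≤ δ * x ^ 4 := by
      calc 3 * x ^ 3 ≤ (δ * x) * x ^ 3 := mul_le_mul_of_nonneg_right h3' hx3
        _ = δ * x ^ 4 := by ring
    have h12 : x ≤ x ^ 2 := by nlinarith
    have h23 : x ^ 2 ≤ x ^ 3 := by nlinarith [sq_nonneg x]
    linarith
  refine hmain.congr' ?_ ?_
  · filter_upwards [Filter.eventually_gt_atTop 0] with n hn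
    have hn' : (0 : ℝ) < n := by exact_mod_cast hn
    rw [sub_eq_add_neg, Real.exp_add, Real.exp_log hn']
  · filter_upwards [Filter.eventually_gt_atTop 0] with n hn
    have hn' : (0 : ℝ) < n := by exact_mod_cast hn
    rw [Real.rpow_def_of_pos hn']
    congr 1; ring

end

theorem mainTheorem5 (K c : ℝ) (hK : 0 < K) (hc : 0 < c) (hc1 : c < 1) :
    ∃ f : ℕ → ℝ,
      f =o[Filter.atTop] (fun n : ℕ => (n : ℝ) ^ (-Real.log (n : ℝ))) ∧
      ∀ (n r : ℕ), 1 ≤ r → 2 * r ≤ n → Real.log (n : ℝ) ^ 4 ≤ (r : ℝ) →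
      ∀ (Ω : Type*) [MeasurableSpace Ω] (μ : MeasureTheory.Measure Ω)
        [MeasureTheory.IsProbabilityMeasure μ] (a : Fin n → Fin n → Ω → ℝ),
        (∀ i j, Measurable (a i j)) →
        ProbabilityTheory.iIndepFun (fun (p : Fin n × Fin n) => a p.1 p.2) μ →
        (∀ i j, ∀ᵐ ω ∂μ, |a i j ω - ∫ ω', a i j ω' ∂μ| ≤ K) →
        (∀ i j, c ≤ ProbabilityTheory.variance (a i j) μ ∧
          ProbabilityTheory.variance (a i j) μ ≤ 1 / c) →
        μ.real {ω | ascSingularValue (Matrix.of fun i j => a i j ω) (2 * r) ≤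
          (r : ℝ) * c ^ 2 / (2 * Real.sqrt ((n : ℝ) - (r : ℝ)))} ≤ f n := by
  have hlam0 : 0 ≤ 1 / (8 * K ^ 2) := by positivity
  have hlam : 1 / (8 * K ^ 2) * K ^ 2 = 1 / 8 := by field_simp
  refine ⟨fun n => n * Real.exp (-(1 / (8 * K ^ 2) * c / 4 * Real.log n ^ 4)),
    mul_exp_neg_log_pow_four_isLittleO (by positivity), ?_⟩
  intro n r hr h2r hlog Ω _ μ _ a hmeas hind hbound hvar
  refine (measureReal_ascSingularValue_le hlam hlam0 hc hc1 hr h2r μ a hmeas hind hbound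
    fun i j => (hvar i j).1).trans ?_
  dsimp only
  gcongr
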